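/- Let $n\ge 2$ and $d\ge 3$ be integers. Let $V$ be an $n$-dimensional complex vector space with coordinates $x_1,\dots,x_n$, let $y_1,\dots,y_n$ be the dual coordinates on $V^\vee$, and identify $\mathcal O(V)=\mathbb C[x_1,\dots,x_n]$ and $\mathcal O(V^\vee)=\mathbb C[y_1,\dots,y_n]$, with degree $j$ components $\mathcal O(V)_j$ and $\mathcal O(V^\vee)_j$. For $h\in\mathcal O(V)$ and $F\in\mathcal O(V^\vee)$ put $h\circ F:=h(\partial/\partial y_1,\dots,\partial/\partial y_n)F$ and $F^\perp:=\{h\in\mathcal O(V)\mid h\circ F=0\}$, an ideal of $\mathcal O(V)$. For a homogeneous ideal $I\subseteq\mathcal O(V)$, a form $F\in\mathcal O(V^\vee)_j$ is called a Macaulay inverse system for $\mathcal O(V)/I$ if $\mathcal O(V)/I$ is a local Artinian Gorenstein algebra of socle degree $j$ (that is, local and Artinian with a one-dimensional socle, the socle being its degree $j$ component) and $I=F^\perp$. **Proposition 2.7.** (i) Let $\mathbf f=(f_1,\dots,f_n)$ be an $n$-tuple of forms $f_i\in\mathcal O(V)_{d-1}$ with nonzero resultant, i.e. without common zeros in $V$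 away from $0$, and let $M(\mathbf f)=\mathcal O(V)/(f_1,\dots,f_n)$ and $\mathrm{jac}(\mathbf f)=\det(\partial f_i/\partial x_j)$. Then there is exactly one form $\mathbf A(\mathbf f)\in\mathcal O(V^\vee)_{n(d-2)}$ (the associated form of $\mathbf f$) such that $$(y_1\bar x_1+\dots+y_n\bar x_n)^{n(d-2)}=\mathbf A(\mathbf f)(y_1,\dots,y_n)\cdot\overline{\mathrm{jac}(\mathbf f)}\quad\text{in } M(\mathbf f)[y_1,\dots,y_n],$$ where bars denote classes in $M(\mathbf f)$, and $\mathbf A(\mathbf f)$ is a Macaulay inverse system for $M(\mathbf f)$; in particular $(f_1,\dots,f_n)=\mathbf A(\mathbf f)^\perp$. (ii) Let $f\in\mathcal O(V)_d$ be a form with nonzero discriminant, i.e. such that the hypersurface $f=0$ has an isolated singularity at $0$, and let $M(f)=\mathcal O(V)/(\partial f/\partial x_1,\dots,\partial f/\partial x_n)$ be its Milnor algebra and $\mathrm{hess}(f)=\det(\partial^2 f/\partial x_i\partial x_j)$. Then there is exactly one form $A(f)\in\mathcal O(V^\vee)_{n(d-2)}$ (the associated form of $f$) such that $(y_1\bar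 x_1+\dots+y_n\bar x_n)^{n(d-2)}=A(f)(y_1,\dots,y_n)\cdot\overline{\mathrm{hess}(f)}$ in $M(f)[y_1,\dots,y_n]$, and $A(f)$ is a Macaulay inverse system for $M(f)$. -/

import Mathlib

open MvPolynomial Filter Topology

noncomputable section

namespace AssocForm

/-! Coordinates `x₁, …, xₙ` on an `n`-dimensional complex vector space `V` identify the algebra of
polynomial functions `O(V)` with `MvPolynomial (Fin n) ℂ`; the dual coordinates `y₁, …, yₙ` identify
`O(V^∨)` with `MvPolynomial (Fin n) ℂ` as well. -/

/-- The resultant of `n` forms in `n` variables is nonzero: the forms have no common zero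
away from the origin. -/
def ResultantNeZero {n : ℕ} (f : Fin n → MvPolynomial (Fin n) ℂ) : Prop :=
  ∀ x : Fin n → ℂ, (∀ i, eval x (f i) = 0) → x = 0

/-- The discriminant of a form of degree `d ≥ 3` is nonzero: the hypersurface `f = 0` has an
isolated singularity at the origin, that is, no point near the origin and different from it is a
singular point of the hypersurface. -/
def DiscriminantNeZero {n : ℕ} (f : MvPolynomial (Fin n) ℂ) : Prop :=
  ∀ᶠ x in 𝓝[≠] (0 : Fin n → ℂ), ¬ (eval x f = 0 ∧ ∀ i, eval x (pderiv i f) = 0)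

/-- The `n`-tuple of first order partial derivatives of `f`. -/
def grad {n : ℕ} (f : MvPolynomial (Fin n) ℂ) : Fin n → MvPolynomial (Fin n) ℂ :=
  fun i => pderiv i f

/-- The Jacobian `det (∂ fᵢ / ∂ xⱼ)`. -/
def jac {n : ℕ} (f : Fin n → MvPolynomial (Fin n) ℂ) : MvPolynomial (Fin n) ℂ :=
  Matrix.det (Matrix.of fun i j => pderiv j (f i))

/-- The Hessian `det (∂² f / ∂ xᵢ ∂ xⱼ)`. -/
def hess {n : ℕ} (f : MvPolynomial (Fin n) ℂ) : MvPolynomial (Fin n) ℂ :=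
  Matrix.det (Matrix.of fun i j => pderiv i (pderiv j f))

/-- The ideal `(f₁, …, fₙ)`. -/
def tupleIdeal {n : ℕ} (f : Fin n → MvPolynomial (Fin n) ℂ) : Ideal (MvPolynomial (Fin n) ℂ) :=
  Ideal.span (Set.range f)

/-- `F` is a form of degree `N` in `y₁, …, yₙ` with
`(y₁ x̄₁ + ⋯ + yₙ x̄ₙ) ^ N = F(y₁, …, yₙ) · s̄` in `(O(V) / I)[y₁, …, yₙ]`,
where the bar denotes the class in `O(V) / I`. -/
def IsAssociatedForm {n : ℕ} (I : Ideal (MvPolynomial (Fin n) ℂ)) (s : MvPolynomial (Fin n) ℂ)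
    (N : ℕ) (F : MvPolynomial (Fin n) ℂ) : Prop :=
  F.IsHomogeneous N ∧
    (∑ i, (X i : MvPolynomial (Fin n) (MvPolynomial (Fin n) ℂ ⧸ I)) *
        C (Ideal.Quotient.mk I (X i))) ^ N =
      map (algebraMap ℂ (MvPolynomial (Fin n) ℂ ⧸ I)) F * C (Ideal.Quotient.mk I s)

/-- The associated form `𝐀(f)` of an `n`-tuple `f` of forms of degree `d - 1`: the form `F` with
`(y₁ x̄₁ + ⋯ + yₙ x̄ₙ) ^ (n (d - 2)) = F · jac(f)` in `M(f)[y₁, …, yₙ]`. -/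
def assocFormTuple {n : ℕ} (d : ℕ) (f : Fin n → MvPolynomial (Fin n) ℂ) :
    MvPolynomial (Fin n) ℂ :=
  Classical.epsilon (IsAssociatedForm (tupleIdeal f) (jac f) (n * (d - 2)))

/-- The associated form `A(f)` of a form `f` of degree `d`: the form `F` with
`(y₁ x̄₁ + ⋯ + yₙ x̄ₙ) ^ (n (d - 2)) = F · hess(f)` in `M(f)[y₁, …, yₙ]`. -/
def assocForm {n : ℕ} (d : ℕ) (f : MvPolynomial (Fin n) ℂ) : MvPolynomial (Fin n) ℂ :=
  Classical.epsilon (IsAssociatedForm (tupleIdeal (grad f)) (hess f) (n * (d - 2)))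

/-- The partial derivative `∂ / ∂ yᵢ` as a linear endomorphism. -/
def pd {n : ℕ} (i : Fin n) : Module.End ℂ (MvPolynomial (Fin n) ℂ) :=
  (pderiv i : Derivation ℂ (MvPolynomial (Fin n) ℂ) (MvPolynomial (Fin n) ℂ)).toLinearMap

theorem commute_pd {n : ℕ} (i j : Fin n) : Commute (pd i) (pd j) := by
  let D : Fin n → Derivation ℂ (MvPolynomial (Fin n) ℂ) (MvPolynomial (Fin n) ℂ) := pderiv
  have h : ⁅D i, D j⁆ = 0 := by
    apply MvPolynomial.derivation_ext
    intro k
    rw [Derivation.commutator_apply]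
    by_cases hi : i = k <;> by_cases hj : j = k <;>
      simp [D, pderiv_X, Pi.single_apply, apply_ite]
  refine LinearMap.ext fun p => ?_
  have h' : ⁅D i, D j⁆ p = 0 := by rw [h]; rfl
  rw [Derivation.commutator_apply, sub_eq_zero] at h'
  exact h'

theorem pairwise_commute_pd_pow {n : ℕ} (α β : Fin n →₀ ℕ) :
    ((Finset.univ : Finset (Fin n)) : Set (Fin n)).Pairwise
      fun i j => Commute (pd i ^ α i) (pd j ^ β j) :=
  fun i _ j _ _ => (commute_pd i j).pow_pow _ _

/-- The operator `∂ ^ |α| / ∂ y₁ ^ α₁ ⋯ ∂ yₙ ^ αₙ`. -/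
def iterPDeriv {n : ℕ} (α : Fin n →₀ ℕ) : Module.End ℂ (MvPolynomial (Fin n) ℂ) :=
  Finset.univ.noncommProd (fun i => pd i ^ α i) (pairwise_commute_pd_pow α α)

/-- The action `h ∘ F = h(∂/∂y₁, …, ∂/∂yₙ) F` of `O(V)` on `O(V^∨)`. -/
def polar {n : ℕ} (h F : MvPolynomial (Fin n) ℂ) : MvPolynomial (Fin n) ℂ :=
  ∑ α ∈ h.support, h.coeff α • iterPDeriv α F

theorem iterPDeriv_add {n : ℕ} (α β : Fin n →₀ ℕ) :
    iterPDeriv (α + β) = iterPDeriv α * iterPDeriv β :=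
  (Finset.noncommProd_congr rfl (fun i _ => pow_add (pd i) (α i) (β i)) _).trans
    (Finset.noncommProd_mul_distrib _ _ (pairwise_commute_pd_pow α α)
      (pairwise_commute_pd_pow β β) (pairwise_commute_pd_pow β α))

theorem polar_eq_sum {n : ℕ} (h F : MvPolynomial (Fin n) ℂ) :
    polar h F = Finsupp.sum (AddMonoidAlgebra.coeff h) fun α c => c • iterPDeriv α F := rfl

theorem polar_add {n : ℕ} (g h F : MvPolynomial (Fin n) ℂ) :
    polar (g + h) F = polar g F + polar h F := by
  simp only [polar_eq_sum]
  exact Finsupp.sum_add_index' (by simp) (by intros; rw [add_smul])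

theorem polar_monomial {n : ℕ} (α : Fin n →₀ ℕ) (c : ℂ) (F : MvPolynomial (Fin n) ℂ) :
    polar (monomial α c) F = c • iterPDeriv α F := by
  rw [polar_eq_sum]
  exact Finsupp.sum_single_index (by simp)

theorem polar_monomial_mul {n : ℕ} (α : Fin n →₀ ℕ) (c : ℂ) (h F : MvPolynomial (Fin n) ℂ) :
    polar (monomial α c * h) F = c • iterPDeriv α (polar h F) := by
  induction h using MvPolynomial.induction_on' with
  | monomial β b =>
    rw [monomial_mul, polar_monomial, polar_monomial, iterPDeriv_add, map_smul, smul_smul]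
    rfl
  | add p q hp hq => rw [mul_add, polar_add, hp, hq, polar_add, map_add, smul_add]

theorem polar_mul {n : ℕ} (g h F : MvPolynomial (Fin n) ℂ) (hF : polar h F = 0) :
    polar (g * h) F = 0 := by
  induction g using MvPolynomial.induction_on' with
  | monomial β b => rw [polar_monomial_mul, hF, map_zero, smul_zero]
  | add p q hp hq => rw [add_mul, polar_add, hp, hq, add_zero]

/-- The ideal `F^⊥ = {h ∈ O(V) | h ∘ F = 0}`. -/
def perp {n : ℕ} (F : MvPolynomial (Fin n) ℂ) : Ideal (MvPolynomial (Fin n) ℂ) where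
  carrier := {h | polar h F = 0}
  zero_mem' := by simp [polar]
  add_mem' := fun {a b} ha hb => by
    have ha' : polar a F = 0 := ha
    have hb' : polar b F = 0 := hb
    simp [polar_add, ha', hb']
  smul_mem' := fun c h hh => polar_mul c h F hh

/-- The socle of a local ring: the annihilator of its maximal ideal. -/
def socle (R : Type*) [CommRing R] [IsLocalRing R] : Ideal R :=
  (IsLocalRing.maximalIdeal R).annihilator

/-- For a homogeneous ideal `I`, the algebra `O(V) / I` is a local Artinian Gorenstein algebra of
socle degree `j`: it is local and Artinian, its socle is one-dimensional, and the socle is the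
degree `j` component of `O(V) / I`. -/
def IsGorensteinOfSocleDegree {n : ℕ} (I : Ideal (MvPolynomial (Fin n) ℂ)) (j : ℕ) : Prop :=
  IsArtinianRing (MvPolynomial (Fin n) ℂ ⧸ I) ∧
    ∃ _ : IsLocalRing (MvPolynomial (Fin n) ℂ ⧸ I),
      Module.finrank ℂ (socle (MvPolynomial (Fin n) ℂ ⧸ I)) = 1 ∧
      (socle (MvPolynomial (Fin n) ℂ ⧸ I) : Set (MvPolynomial (Fin n) ℂ ⧸ I)) =
        Ideal.Quotient.mk I '' {h | h.IsHomogeneous j}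

/-- `F` is a (homogeneous) Macaulay inverse system for `O(V) / I`: the ideal `I` is homogeneous,
`O(V) / I` is a local Artinian Gorenstein algebra of socle degree `j`, `F` is a form of degree `j`,
and `I = F^⊥`. -/
structure IsMacaulayInverseSystem {n : ℕ} (I : Ideal (MvPolynomial (Fin n) ℂ)) (j : ℕ)
    (F : MvPolynomial (Fin n) ℂ) : Prop where
  isHomogeneous_ideal : ∀ h ∈ I, ∀ k, homogeneousComponent k h ∈ I
  isGorenstein : IsGorensteinOfSocleDegree I j
  isHomogeneous : F.IsHomogeneous j
  eq_perp : I = perp F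

end AssocForm

end

/-! The heart is that the Jacobian spans the socle of `M(f)`. Euler's relation writes `(d - 1) f = A
x` with `A` the Jacobian matrix, so this is a case of a general fact: if `x` is a regular system
generating the maximal ideal of a local ring and `f = A x` generates a primary ideal, then `det A`
generates the socle modulo `(f)` and is nonzero there.

That fact is encoded in `Linked`, a relation that composes (`Linked.trans`), holds for exchanging a
single member of a family (`Linked.update`), and admits cancellation (`Linked.of_trans`). Powers `u`
of generic scalar combinations `g` of the `f i` are reached from `x` by single exchanges, and from
`g` by lowering exponents. Cancelling links `x` to `g`, and `g` differs from `f` by an invertible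
scalar matrix. Localising at the origin transfers this to polynomials; the Nullstellensatz supplies
primariness.

The socle thus lies in the single degree `N = n (d - 2)`. Every form of degree `N` is a unique
multiple of `jac` modulo the ideal, which determines the associated form `F` coefficient by
coefficient. Up to `N!`, that multiple is the constant `g ∘ F`; since no socle occurs in other
degrees, the resulting pairing has exactly the ideal as kernel, whence `I = F^⊥`. Part (ii) is the
case of a gradient. -/

namespace AssocForm

/-! ### Linked families: composition, exchange and cancellation. -/

section LinkedSequences

variable {R ι : Type*}

theorem image_update_of_notMem [DecidableEq ι] (u : ι → R) {k : ι} (h : R) {s : Set ι}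
    (hk : k ∉ s) : Function.update u k h '' s = u '' s :=
  Set.image_congr fun i hi => Function.update_of_ne (fun e : i = k => hk (e ▸ hi)) _ _

variable [CommRing R]

/-- Every member of the family is a nonzerodivisor modulo any subfamily of the other members. -/
def StronglyRegular (u : ι → R) : Prop :=
  ∀ (s : Set ι) (i : ι), i ∉ s → ∀ y, y * u i ∈ Ideal.span (u '' s) → y ∈ Ideal.span (u '' s)

/-- Only subfamilies containing the new `h` need care: from `y * u i = z * h + b`, regularity of `h`
gives `z = w * u i + c`, and then `u i` cancels from `(y - w * h) * u i`. -/
theorem StronglyRegular.update [DecidableEq ι] {u : ι → R} (hu : StronglyRegular u) {k : ι} {h : R}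
    (hh : ∀ s : Set ι, k ∉ s → ∀ y, y * h ∈ Ideal.span (u '' s) → y ∈ Ideal.span (u '' s)) :
    StronglyRegular (Function.update u k h) := by
  intro s i hi y hy
  by_cases hk : k ∈ s
  · have hik : i ≠ k := fun e => hi (e ▸ hk)
    obtain ⟨t, hkt, rfl⟩ : ∃ t : Set ι, k ∉ t ∧ insert k t = s :=
      ⟨s \ {k}, by simp, by simp [Set.insert_eq_of_mem hk]⟩
    have hit : i ∉ t := fun e => hi (Set.mem_insert_of_mem _ e)
    rw [Set.image_insert_eq, Function.update_self, image_update_of_notMem u h hkt,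
      Ideal.span_insert] at hy ⊢
    rw [Function.update_of_ne hik] at hy
    obtain ⟨a, ha, b, hb, hab⟩ := Submodule.mem_sup.1 hy
    obtain ⟨z, rfl⟩ := Ideal.mem_span_singleton'.1 ha
    have hz : z ∈ Ideal.span (u '' insert i t) := by
      apply hh _ (by simp [hik.symm, hkt])
      rw [Set.image_insert_eq, Ideal.span_insert]
      have : z * h = y * u i - b := by rw [← hab]; ring
      rw [this]
      exact sub_mem (Ideal.mul_mem_left _ _ (Ideal.mem_sup_left (Ideal.mem_span_singleton_self _)))
        (Ideal.mem_sup_right hb)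
    rw [Set.image_insert_eq, Ideal.span_insert] at hz
    obtain ⟨a', ha', c, hc, hac⟩ := Submodule.mem_sup.1 hz
    obtain ⟨w, rfl⟩ := Ideal.mem_span_singleton'.1 ha'
    have hw : y - w * h ∈ Ideal.span (u '' t) := by
      apply hu t i hit
      have : (y - w * h) * u i = b + c * h := by
        rw [← hac] at hab
        linear_combination -hab
      rw [this]
      exact add_mem hb (Ideal.mul_mem_right _ _ hc)
    rw [show y = w * h + (y - w * h) by ring]
    exact add_mem (Ideal.mem_sup_left (Ideal.mem_span_singleton'.2 ⟨w, rfl⟩))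
      (Ideal.mem_sup_right hw)
  · rw [image_update_of_notMem u h hk] at hy ⊢
    by_cases hik : i = k
    · subst hik
      rw [Function.update_self] at hy
      exact hh s hk y hy
    · rw [Function.update_of_ne hik] at hy
      exact hu s i hi y hy

theorem span_range_eq_sup (u : ι → R) (k : ι) :
    Ideal.span (Set.range u) = Ideal.span {u k} ⊔ Ideal.span (u '' {k}ᶜ) := by
  rw [← Ideal.span_insert, ← Set.image_insert_eq, ← Set.image_univ]
  congr 2
  ext i
  simp [em]

theorem span_range_update [DecidableEq ι] (u : ι → R) (k : ι) (h : R) :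
    Ideal.span (Set.range (Function.update u k h)) =
      Ideal.span {h} ⊔ Ideal.span (u '' {k}ᶜ) := by
  rw [span_range_eq_sup _ k, Function.update_self, image_update_of_notMem u h (by simp)]

theorem mulVec_mem [Fintype ι] (A : Matrix ι ι R) (x : ι → R) (i : ι) :
    A.mulVec x i ∈ Ideal.span (Set.range x) := by
  rw [Matrix.mulVec, dotProduct]
  exact sum_mem fun j _ => Ideal.mul_mem_left _ _ (Ideal.subset_span ⟨j, rfl⟩)

variable [Fintype ι] [DecidableEq ι]

/-- The families `x` and `f = A x` satisfy `(f) : (x) ≤ (f, det A)` and `(f) : det A ≤ (x)`. -/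
structure Linked (x f : ι → R) (A : Matrix ι ι R) : Prop where
  mulVec_eq : A.mulVec x = f
  colon_le : ∀ y, (∀ i, y * x i ∈ Ideal.span (Set.range f)) →
    ∃ c, y - c * A.det ∈ Ideal.span (Set.range f)
  colon_det_le : ∀ y, y * A.det ∈ Ideal.span (Set.range f) → y ∈ Ideal.span (Set.range x)

theorem det_mul_mem {K : Ideal R} (A : Matrix ι ι R) (x : ι → R) (h : ∀ i, A.mulVec x i ∈ K)
    (j : ι) : A.det * x j ∈ K := by
  have : A.det * x j = (A.adjugate.mulVec (A.mulVec x)) j := by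
    rw [Matrix.mulVec_mulVec, Matrix.adjugate_mul, Matrix.smul_mulVec, Matrix.one_mulVec]
    rfl
  rw [this, Matrix.mulVec, dotProduct]
  exact sum_mem fun i _ => Ideal.mul_mem_left _ _ (h i)

theorem Linked.span_le {x f : ι → R} {A : Matrix ι ι R} (h : Linked x f A) :
    Ideal.span (Set.range f) ≤ Ideal.span (Set.range x) := by
  rw [Ideal.span_le]
  rintro _ ⟨i, rfl⟩
  rw [← h.mulVec_eq]
  exact mulVec_mem A x i

theorem Linked.refl (x : ι → R) : Linked x x 1 where
  mulVec_eq := Matrix.one_mulVec x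
  colon_le y _ := ⟨y, by simp⟩
  colon_det_le y hy := by simpa using hy

/-- If `y` carries `(x)` into `(g)`, it carries `(f)` there too, so `y ≡ c * det B`. Cancelling `det
B` shows that `c` carries `(x)` into `(f)`, so `c ≡ e * det A`; finally `det B` maps `(f)` into
`(g)` by Cramer's rule. -/
theorem Linked.trans {x f g : ι → R} {A B : Matrix ι ι R} (h : Linked x f A) (h' : Linked f g B) :
    Linked x g (B * A) where
  mulVec_eq := by rw [← Matrix.mulVec_mulVec, h.mulVec_eq, h'.mulVec_eq]
  colon_le y hy := by
    have key : ∀ z ∈ Ideal.span (Set.range x), y * z ∈ Ideal.span (Set.range g) := by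
      intro z hz
      have : Ideal.span (Set.range x) ≤ (Ideal.span (Set.range g)).colon {y} := by
        rw [Ideal.span_le]
        rintro _ ⟨i, rfl⟩
        simpa [Submodule.mem_colon_singleton, mul_comm] using hy i
      simpa [Submodule.mem_colon_singleton, mul_comm] using this hz
    obtain ⟨c, hc⟩ := h'.colon_le y fun i => key _ (h.span_le (Ideal.subset_span ⟨i, rfl⟩))
    obtain ⟨e, he⟩ := h.colon_le c fun i => by
      apply h'.colon_det_le
      have : c * x i * B.det = y * x i - (y - c * B.det) * x i := by ring
      rw [this]
      exact sub_mem (hy i) (Ideal.mul_mem_right _ _ hc)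
    refine ⟨e, ?_⟩
    have hB : ∀ z ∈ Ideal.span (Set.range f), B.det * z ∈ Ideal.span (Set.range g) := by
      intro z hz
      have : Ideal.span (Set.range f) ≤ (Ideal.span (Set.range g)).colon {B.det} := by
        rw [Ideal.span_le]
        rintro _ ⟨i, rfl⟩
        have := det_mul_mem (K := Ideal.span (Set.range g)) B f
          (fun i => by rw [h'.mulVec_eq]; exact Ideal.subset_span ⟨i, rfl⟩) i
        simpa [Submodule.mem_colon_singleton, mul_comm] using this
      simpa [Submodule.mem_colon_singleton, mul_comm] using this hz
    have : y - e * (B * A).det = (y - c * B.det) + B.det * (c - e * A.det) := by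
      rw [Matrix.det_mul]; ring
    rw [this]
    exact add_mem hc (hB _ he)
  colon_det_le y hy := by
    apply h.colon_det_le
    apply h'.colon_det_le
    rwa [Matrix.det_mul, mul_comm B.det, ← mul_assoc] at hy

/-- Write `h = ∑ e j * u j` and take the identity matrix with row `k` replaced by `e`. Its
determinant is `e k`, and `h ≡ e k * u k` modulo the other members, so both colon conditions come
down to cancelling `u k` or `h`. -/
theorem Linked.update {u : ι → R} {k : ι} {h : R} (hh : h ∈ Ideal.span (Set.range u))
    (hu : ∀ y, y * u k ∈ Ideal.span (u '' {k}ᶜ) → y ∈ Ideal.span (u '' {k}ᶜ))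
    (hreg : ∀ y, y * h ∈ Ideal.span (u '' {k}ᶜ) → y ∈ Ideal.span (u '' {k}ᶜ)) :
    ∃ E, Linked u (Function.update u k h) E := by
  obtain ⟨e, he⟩ := Ideal.mem_span_range_iff_exists_fun.1 hh
  have hdet : ((1 : Matrix ι ι R).updateRow k e).det = e k := by
    rw [← Matrix.cramer_transpose_apply, Matrix.transpose_one, Matrix.cramer_one]
    rfl
  set K := Ideal.span (u '' {k}ᶜ) with hK
  have hKe : h - e k * u k ∈ K := by
    rw [← he, ← Finset.add_sum_erase _ _ (Finset.mem_univ k), add_sub_cancel_left]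
    refine sum_mem fun j hj => Ideal.mul_mem_left _ _ (Ideal.subset_span ⟨j, ?_, rfl⟩)
    simpa using hj
  refine ⟨(1 : Matrix ι ι R).updateRow k e, ?_, ?_, ?_⟩
  · rw [← he]
    ext i
    by_cases hik : i = k
    · subst hik
      simp [Matrix.mulVec, dotProduct]
    · simp [Matrix.mulVec, dotProduct, hik, Matrix.one_apply]
  · intro y hy
    have hy' := hy k
    rw [span_range_update] at hy' ⊢
    obtain ⟨a, ha, b, hb, hab⟩ := Submodule.mem_sup.1 hy'
    obtain ⟨c, rfl⟩ := Ideal.mem_span_singleton'.1 ha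
    refine ⟨c, ?_⟩
    rw [hdet]
    refine Ideal.mem_sup_right (hu _ ?_)
    have : (y - c * e k) * u k = b + c * (h - e k * u k) := by linear_combination -hab
    rw [this]
    exact add_mem hb (Ideal.mul_mem_left _ _ hKe)
  · intro y hy
    rw [hdet, span_range_update] at hy
    rw [span_range_eq_sup u k]
    obtain ⟨a, ha, b, hb, hab⟩ := Submodule.mem_sup.1 hy
    obtain ⟨c, rfl⟩ := Ideal.mem_span_singleton'.1 ha
    have : y - c * u k ∈ K := by
      apply hreg
      -- Modulo `K`, `h ≡ e k * u k` and `y * e k ≡ c * h`, so the product is `≡ u k * (y * e k - c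
      -- * h) ≡ 0`.
      have : (y - c * u k) * h = (y - c * u k) * (h - e k * u k) + u k * (b + c * (h - e k * u k)) := by
        linear_combination -u k * hab
      rw [this]
      exact add_mem (Ideal.mul_mem_left _ _ hKe)
        (Ideal.mul_mem_left _ _ (add_mem hb (Ideal.mul_mem_left _ _ hKe)))
    rw [show y = c * u k + (y - c * u k) by ring]
    exact add_mem (Ideal.mem_sup_left (Ideal.mem_span_singleton'.2 ⟨c, rfl⟩))
      (Ideal.mem_sup_right this)

/-- The difference is `det Z`, where row `k` of `Z` kills `x` and the other rows send `x` to the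
other `u i`. By Cramer `det Z` multiplies every `x j`, hence `u k`, into the ideal of those `u i`,
and `u k` cancels. -/
theorem det_updateRow_sub_mem {x u : ι → R} (hu : StronglyRegular u) {M : Matrix ι ι R}
    (hM : M.mulVec x = u) (k : ι) {r : ι → R} (hr : r ⬝ᵥ x = u k) :
    (M.updateRow k r).det - M.det ∈ Ideal.span (Set.range u) := by
  set Z := M.updateRow k (r - M k) with hZ
  have hdet : (M.updateRow k r).det - M.det = Z.det := by
    have := Matrix.det_updateRow_add M k (r - M k) (M k)
    rw [sub_add_cancel, Matrix.updateRow_eq_self] at this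
    rw [this, add_sub_cancel_right]
  have hZx : ∀ i, Z.mulVec x i ∈ Ideal.span (u '' {k}ᶜ) := by
    intro i
    by_cases hik : i = k
    · subst hik
      have : Z.mulVec x i = 0 := by
        rw [hZ, Matrix.mulVec, Matrix.updateRow_self, sub_dotProduct, hr, ← hM]
        exact sub_self _
      rw [this]
      exact zero_mem _
    · have : Z.mulVec x i = u i := by
        rw [hZ, Matrix.mulVec, Matrix.updateRow_ne hik, ← hM]
        rfl
      rw [this]
      exact Ideal.subset_span ⟨i, hik, rfl⟩
  rw [hdet]
  have : Z.det ∈ Ideal.span (u '' {k}ᶜ) := by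
    apply hu _ k (by simp)
    rw [← hM, Matrix.mulVec, dotProduct, Finset.mul_sum]
    refine sum_mem fun j _ => ?_
    rw [mul_left_comm, hM]
    exact Ideal.mul_mem_left _ _ (det_mul_mem Z x hZx j)
  exact Ideal.span_mono (Set.image_subset_range _ _) this

/-- Exchanging rows one at a time shows that the transition determinant depends, modulo `(u)`, only
on the two families. -/
theorem det_sub_det_mem {x u : ι → R} (hu : StronglyRegular u) {M M' : Matrix ι ι R}
    (hM : M.mulVec x = u) (hM' : M'.mulVec x = u) :
    M'.det - M.det ∈ Ideal.span (Set.range u) := by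
  suffices H : ∀ s : Finset ι, ∃ N : Matrix ι ι R, N.mulVec x = u ∧ (∀ i ∈ s, N i = M' i) ∧
      N.det - M.det ∈ Ideal.span (Set.range u) by
    obtain ⟨N, -, h, h'⟩ := H Finset.univ
    rwa [show N = M' from funext fun i => h i (Finset.mem_univ i)] at h'
  intro s
  induction s using Finset.induction_on with
  | empty => exact ⟨M, hM, by simp, by simp⟩
  | insert k s hk ih =>
    obtain ⟨N, hN, hs, hd⟩ := ih
    have hr : M' k ⬝ᵥ x = u k := by rw [← hM']; rfl
    refine ⟨N.updateRow k (M' k), ?_, ?_, ?_⟩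
    · ext i
      by_cases hik : i = k
      · subst hik
        rw [Matrix.mulVec, Matrix.updateRow_self, hr]
      · rw [Matrix.mulVec, Matrix.updateRow_ne hik, ← hN]
        rfl
    · intro i hi
      by_cases hik : i = k
      · subst hik
        exact Matrix.updateRow_self
      · rw [Matrix.updateRow_ne hik]
        exact hs i ((Finset.mem_insert.1 hi).resolve_left hik)
    · rw [← sub_add_sub_cancel _ N.det]
      exact add_mem (det_updateRow_sub_mem hu hN k hr) hd

/-- Both `B * A` and `D` carry `x` to `u`, so `det B * det A ≡ det D` modulo `(u)`; the second link
is then cancelled from the composite. -/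
theorem Linked.of_trans {x f u : ι → R} {A B D : Matrix ι ι R} (hu : StronglyRegular u)
    (hf : A.mulVec x = f) (h : Linked x u D) (h' : Linked f u B) : Linked x f A := by
  have hBA : (B * A).mulVec x = u := by rw [← Matrix.mulVec_mulVec, hf, h'.mulVec_eq]
  have hd := det_sub_det_mem hu hBA h.mulVec_eq
  rw [Matrix.det_mul] at hd
  have hB : ∀ i, f i * B.det ∈ Ideal.span (Set.range u) := fun i => by
    rw [mul_comm]
    exact det_mul_mem B f (fun j => by rw [h'.mulVec_eq]; exact Ideal.subset_span ⟨j, rfl⟩) i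
  have hB' : ∀ z ∈ Ideal.span (Set.range f), z * B.det ∈ Ideal.span (Set.range u) := by
    intro z hz
    have : Ideal.span (Set.range f) ≤ (Ideal.span (Set.range u)).colon {B.det} := by
      rw [Ideal.span_le]
      rintro _ ⟨i, rfl⟩
      simpa [Submodule.mem_colon_singleton] using hB i
    simpa [Submodule.mem_colon_singleton] using this hz
  refine ⟨hf, fun y hy => ?_, fun y hy => ?_⟩
  · obtain ⟨c, hc⟩ := h.colon_le (y * B.det) fun i => by
      rw [mul_right_comm]
      exact hB' _ (hy i)
    refine ⟨c, h'.colon_det_le _ ?_⟩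
    have : (y - c * A.det) * B.det = (y * B.det - c * D.det) + c * (D.det - B.det * A.det) := by
      ring
    rw [this]
    exact add_mem hc (Ideal.mul_mem_left _ _ hd)
  · apply h.colon_det_le
    have : y * D.det = y * A.det * B.det + y * (D.det - B.det * A.det) := by ring
    rw [this]
    exact add_mem (hB' _ hy) (Ideal.mul_mem_left _ _ hd)

end LinkedSequences

/-! ### Systems of parameters in a Noetherian local ring. -/

section Local

variable {R ι : Type*} [CommRing R]

/-- The zero divisors on `R ⧸ K` form the union of its associated primes, which turns regularity
into prime avoidance. -/
theorem regular_quotient_iff [IsNoetherianRing R] (K : Ideal R) (r : R) :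
    (∀ y, y * r ∈ K → y ∈ K) ↔ ∀ P ∈ associatedPrimes R (R ⧸ K), r ∉ P := by
  have H := biUnion_associatedPrimes_eq_zero_divisors R (R ⧸ K)
  have H' : (∃ P ∈ associatedPrimes R (R ⧸ K), r ∈ P) ↔ ∃ x : R ⧸ K, x ≠ 0 ∧ r • x = 0 := by
    have := Set.ext_iff.1 H r
    simpa using this
  constructor
  · intro h P hP hr
    obtain ⟨x, hx, hrx⟩ := H'.1 ⟨P, hP, hr⟩
    obtain ⟨y, rfl⟩ := Ideal.Quotient.mk_surjective x
    apply hx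
    rw [Ideal.Quotient.eq_zero_iff_mem]
    apply h
    rw [← Ideal.Quotient.eq_zero_iff_mem, mul_comm]
    exact hrx
  · intro h y hy
    by_contra hyK
    obtain ⟨P, hP, hr⟩ := H'.2 ⟨Ideal.Quotient.mk K y,
      fun e => hyK (Ideal.Quotient.eq_zero_iff_mem.1 e), by
        rw [← Ideal.Quotient.eq_zero_iff_mem, mul_comm] at hy
        exact hy⟩
    exact h P hP hr

/-- A vector space over an infinite field is not a finite union of proper subspaces. Having the
coefficients in `k` makes the later transition determinant a unit as soon as it is nonzero. -/
theorem exists_combination_notMem {k : Type*} [Field k] [Infinite k] [Algebra k R] [Fintype ι]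
    (f : ι → R) {S : Set (Ideal R)} (hS : S.Finite) (h : ∀ P ∈ S, ∃ i, f i ∉ P) :
    ∃ c : ι → k, ∀ P ∈ S, ∑ i, c i • f i ∉ P := by
  classical
  let φ : (ι → k) →ₗ[k] R := Fintype.linearCombination k f
  let W : Ideal R → Submodule k (ι → k) := fun P => (P.restrictScalars k).comap φ
  have hW : (⊤ : Submodule k (ι → k)) ∉ hS.toFinset.image W := by
    intro hmem
    obtain ⟨P, hP, hPW⟩ := Finset.mem_image.1 hmem
    obtain ⟨i, hi⟩ := h P (hS.mem_toFinset.1 hP)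
    have : Pi.single i (1 : k) ∈ W P := hPW ▸ Submodule.mem_top
    apply hi
    simpa [W, φ, Fintype.linearCombination_apply_single] using this
  obtain ⟨c, hc⟩ := (Set.ne_univ_iff_exists_notMem _).1
    (Subspace.biUnion_ne_univ_of_top_notMem hW)
  refine ⟨c, fun P hP hcP => hc ?_⟩
  simp only [Set.mem_iUnion]
  exact ⟨W P, Finset.mem_image_of_mem _ (hS.mem_toFinset.2 hP), hcP⟩

variable [IsLocalRing R] [IsNoetherianRing R]

open IsLocalRing in
-- A prime containing the new family and strictly below the maximal ideal would, by Krull's height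
-- argument, be minimal over the ideal of the other members. It would then be an associated prime
-- containing the nonzerodivisor `h`.
theorem maximalIdeal_le_radical_update [Fintype ι] [DecidableEq ι] {u : ι → R} {k : ι} {h : R}
    (hum : ∀ i, u i ∈ maximalIdeal R)
    (hu : maximalIdeal R ≤ (Ideal.span (Set.range u)).radical)
    (hreg : ∀ y, y * h ∈ Ideal.span (u '' {k}ᶜ) → y ∈ Ideal.span (u '' {k}ᶜ)) :
    maximalIdeal R ≤ (Ideal.span (Set.range (Function.update u k h))).radical := by
  rw [span_range_update]
  rw [span_range_eq_sup u k, ← Ideal.span_insert] at hu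
  rw [Ideal.radical_eq_sInf]
  refine le_sInf ?_
  rintro P ⟨hP, hPp⟩
  by_contra hPm
  have hlt : P < maximalIdeal R := lt_of_le_of_ne (le_maximalIdeal hPp.ne_top) fun e => hPm e.ge
  have hmin : maximalIdeal R ∈ (Ideal.span (insert (u k) (u '' {k}ᶜ))).minimalPrimes := by
    refine ⟨⟨(maximalIdeal.isMaximal R).isPrime, ?_⟩, fun Q hQ _ => ?_⟩
    · rw [Ideal.span_le, Set.insert_subset_iff]
      refine ⟨hum k, ?_⟩
      rintro _ ⟨i, -, rfl⟩
      exact hum i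
    · exact hu.trans (hQ.1.radical_le_iff.2 hQ.2)
  have hPmin := Ideal.mem_minimalPrimes_span_of_mem_minimalPrimes_span_insert hlt (u k) _ hmin
    (u '' {k}ᶜ) (fun x hx => hP (Ideal.mem_sup_right (Ideal.subset_span hx)))
    (fun x hx => Ideal.le_radical (Ideal.subset_span (Set.mem_insert_of_mem _ hx)))
  have hass : P ∈ associatedPrimes R (R ⧸ Ideal.span (u '' {k}ᶜ)) := by
    apply Module.associatedPrimes.minimalPrimes_annihilator_subset_associatedPrimes
    rwa [Ideal.annihilator_quotient]
  exact (regular_quotient_iff _ h).1 hreg P hass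
    (hP (Ideal.mem_sup_left (Ideal.mem_span_singleton_self h)))

theorem mem_of_mul_pow_mem {R : Type*} [CommRing R] {K : Ideal R} {r : R}
    (hr : ∀ y, y * r ∈ K → y ∈ K) (n : ℕ) : ∀ y, y * r ^ n ∈ K → y ∈ K := by
  induction n with
  | zero => simp
  | succ n ih =>
    intro y hy
    rw [pow_succ, ← mul_assoc] at hy
    exact ih y (hr _ hy)

variable [Fintype ι] [DecidableEq ι]

open IsLocalRing in
-- Each `x l` is exchanged for a power of a generic combination `g` of the `f j`. Genericity gives
-- regularity; a power is taken because `Linked.update` needs an element of the current ideal.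
theorem exists_linked_powers (k : Type*) [Field k] [Infinite k] [Algebra k R] {x f : ι → R}
    (hx : StronglyRegular x) (hxm : Ideal.span (Set.range x) = maximalIdeal R)
    (hfm : ∀ i, f i ∈ maximalIdeal R)
    (hf : maximalIdeal R ≤ (Ideal.span (Set.range f)).radical) :
    ∃ (c : Matrix ι ι k) (a : ι → ℕ) (D : Matrix ι ι R),
      StronglyRegular (fun i => (∑ j, c i j • f j) ^ (a i + 1)) ∧
      Linked x (fun i => (∑ j, c i j • f j) ^ (a i + 1)) D := by
  suffices H : ∀ s : Finset ι, ∃ (c : ι → ι → k) (a : ι → ℕ) (u : ι → R) (D : Matrix ι ι R),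
      StronglyRegular u ∧ (∀ i ∈ s, u i = (∑ j, c i j • f j) ^ (a i + 1)) ∧
      (∀ i ∉ s, u i = x i) ∧ (∀ i, u i ∈ maximalIdeal R) ∧
      maximalIdeal R ≤ (Ideal.span (Set.range u)).radical ∧ Linked x u D by
    obtain ⟨c, a, u, D, hu, hs, -, -, -, hD⟩ := H Finset.univ
    obtain rfl : u = fun i => (∑ j, c i j • f j) ^ (a i + 1) :=
      funext fun i => hs i (Finset.mem_univ i)
    exact ⟨c, a, D, hu, hD⟩
  intro s
  induction s using Finset.induction_on with
  | empty =>
    refine ⟨0, 0, x, 1, hx, by simp, by simp, fun i => ?_, ?_, Linked.refl x⟩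
    · rw [← hxm]
      exact Ideal.subset_span ⟨i, rfl⟩
    · rw [hxm]
      exact Ideal.le_radical
  | insert l s hl ih =>
    obtain ⟨c, a, u, D, hu, hs, hs', hum, hur, hD⟩ := ih
    have hfin : (⋃ t : {t : Set ι // l ∉ t},
        associatedPrimes R (R ⧸ Ideal.span (u '' t.1))).Finite :=
      Set.finite_iUnion fun t => associatedPrimes.finite R _
    obtain ⟨e, he⟩ := exists_combination_notMem (k := k) f hfin (by
      intro P hP
      obtain ⟨t, ht⟩ := Set.mem_iUnion.1 hP
      -- A prime containing every `f i` contains the maximal ideal, hence `u l`, which is regular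
      -- modulo the subfamily.
      by_contra! hcon
      have hPp : P.IsPrime := IsAssociatedPrime.isPrime ht
      have hle : maximalIdeal R ≤ P := hf.trans <| hPp.radical_le_iff.2 <| by
        rw [Ideal.span_le]
        rintro _ ⟨i, rfl⟩
        exact hcon i
      exact (regular_quotient_iff _ _).1 (hu t.1 l t.2) P ht (hle (hum l)))
    set g := ∑ j, e j • f j with hg
    have hgreg : ∀ t : Set ι, l ∉ t → ∀ y, y * g ∈ Ideal.span (u '' t) →
        y ∈ Ideal.span (u '' t) := fun t ht =>
      (regular_quotient_iff _ g).2 fun P hP => he P (Set.mem_iUnion.2 ⟨⟨t, ht⟩, hP⟩)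
    have hgm : g ∈ maximalIdeal R := sum_mem fun j _ => by
      rw [Algebra.smul_def]
      exact Ideal.mul_mem_left _ _ (hfm j)
    obtain ⟨b, hb⟩ := hur hgm
    have hb' : g ^ (b + 1) ∈ Ideal.span (Set.range u) := by
      rw [pow_succ]
      exact Ideal.mul_mem_right _ _ hb
    have hreg : ∀ t : Set ι, l ∉ t → ∀ y, y * g ^ (b + 1) ∈ Ideal.span (u '' t) →
        y ∈ Ideal.span (u '' t) := fun t ht => mem_of_mul_pow_mem (hgreg t ht) _
    have hgm' : g ^ (b + 1) ∈ maximalIdeal R := Ideal.pow_mem_of_mem _ hgm _ (Nat.succ_pos b)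
    obtain ⟨E, hE⟩ := Linked.update hb' (hu _ l (by simp)) (hreg _ (by simp))
    refine ⟨Function.update c l e, Function.update a l b, Function.update u l (g ^ (b + 1)), E * D,
      hu.update hreg, ?_, ?_, ?_, ?_, hD.trans hE⟩
    · intro i hi
      by_cases hil : i = l
      · subst hil
        simp [hg]
      · simp only [Function.update_of_ne hil]
        exact hs i ((Finset.mem_insert.1 hi).resolve_left hil)
    · intro i hi
      rw [Finset.mem_insert, not_or] at hi
      rw [Function.update_of_ne hi.1]
      exact hs' i hi.2
    · intro i
      by_cases hil : i = l
      · subst hil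
        simpa using hgm'
      · simpa [Function.update_of_ne hil] using hum i
    · exact maximalIdeal_le_radical_update hum hur (hreg _ (by simp))

/-- A factor of a nonzerodivisor is a nonzerodivisor, so each power can be lowered to `g l` without
losing regularity, and each lowering reverses an exchange. -/
theorem exists_linked_of_powers {R : Type*} [CommRing R] {g : ι → R} {a : ι → ℕ}
    (hu : StronglyRegular fun i => g i ^ (a i + 1)) :
    StronglyRegular g ∧ ∃ B, Linked g (fun i => g i ^ (a i + 1)) B := by
  set u : ι → R := fun i => g i ^ (a i + 1) with hudef
  suffices H : ∀ s : Finset ι, ∃ (v : ι → R) (B : Matrix ι ι R), StronglyRegular v ∧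
      (∀ i ∈ s, v i = g i) ∧ (∀ i ∉ s, v i = u i) ∧ Linked v u B by
    obtain ⟨v, B, hv, hs, -, hB⟩ := H Finset.univ
    obtain rfl : v = g := funext fun i => hs i (Finset.mem_univ i)
    exact ⟨hv, B, hB⟩
  intro s
  induction s using Finset.induction_on with
  | empty => exact ⟨u, 1, hu, by simp, by simp, Linked.refl u⟩
  | insert l s hl ih =>
    obtain ⟨v, B, hv, hs, hs', hB⟩ := ih
    have hvl : v l = g l ^ a l * g l := by rw [hs' l hl, ← pow_succ]
    have hreg : ∀ t : Set ι, l ∉ t → ∀ y, y * g l ∈ Ideal.span (v '' t) →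
        y ∈ Ideal.span (v '' t) := by
      intro t ht y hy
      apply hv t l ht
      rw [hvl, mul_left_comm]
      exact Ideal.mul_mem_left _ _ hy
    have hv' := hv.update hreg
    obtain ⟨E, hE⟩ : ∃ E, Linked (Function.update v l (g l)) v E := by
      have := Linked.update (u := Function.update v l (g l)) (k := l) (h := v l) ?_
        (hv' _ l (by simp)) ?_
      · simpa using this
      · rw [hvl]
        exact Ideal.mul_mem_left _ _ (Ideal.subset_span ⟨l, by simp⟩)
      · rw [image_update_of_notMem v _ (by simp)]
        exact hv _ l (by simp)
    refine ⟨_, _, hv', ?_, ?_, hE.trans hB⟩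
    · intro i hi
      by_cases hil : i = l
      · subst hil
        simp
      · rw [Function.update_of_ne hil]
        exact hs i ((Finset.mem_insert.1 hi).resolve_left hil)
    · intro i hi
      rw [Finset.mem_insert, not_or] at hi
      rw [Function.update_of_ne hi.1]
      exact hs' i hi.2

open IsLocalRing in
/-- A family of as many elements as a strongly regular family `x` of generators of the maximal
ideal, and generating a primary ideal to it, is linked to `x` by any transition matrix. -/
theorem linked_of_maximalIdeal_le_radical (k : Type*) [Field k] [Infinite k] [Algebra k R]
    {x f : ι → R} {A : Matrix ι ι R} (hA : A.mulVec x = f)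
    (hx : StronglyRegular x) (hxm : Ideal.span (Set.range x) = maximalIdeal R)
    (hf : maximalIdeal R ≤ (Ideal.span (Set.range f)).radical) : Linked x f A := by
  have hfm : ∀ i, f i ∈ maximalIdeal R := fun i => by
    rw [← hxm, ← hA]
    exact mulVec_mem A x i
  obtain ⟨c, a, D, hu, hD⟩ := exists_linked_powers k hx hxm hfm hf
  obtain ⟨hg, B, hB⟩ := exists_linked_of_powers hu
  set g : ι → R := fun i => ∑ j, c i j • f j with hgdef
  let C : Matrix ι ι R := (algebraMap k R).mapMatrix c
  have hC : C.mulVec f = g := by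
    ext i
    simp [C, g, Matrix.mulVec, dotProduct, Algebra.smul_def]
  have hCdet : C.det = algebraMap k R c.det := (RingHom.map_det _ _).symm
  have hgm : ∀ i, g i ∈ maximalIdeal R := fun i => by
    rw [← hC]
    exact (Ideal.span_le.2 (by rintro _ ⟨j, rfl⟩; exact hfm j)) (mulVec_mem C f i)
  -- A left kernel vector of `c` would put some `g l` in the ideal of the others; regularity would
  -- then put `1` there, inside the maximal ideal.
  have hc : c.det ≠ 0 := by
    intro h0
    obtain ⟨v, hv, hvc⟩ := Matrix.exists_vecMul_eq_zero_iff.2 h0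
    obtain ⟨l, hl⟩ := Function.ne_iff.1 hv
    have hsum : ∑ i, v i • g i = 0 := by
      simp only [hgdef, Finset.smul_sum, smul_smul]
      rw [Finset.sum_comm]
      simp only [← Finset.sum_smul]
      refine Finset.sum_eq_zero fun j _ => ?_
      have := congrFun hvc j
      rw [Matrix.vecMul, dotProduct] at this
      rw [this, Pi.zero_apply, zero_smul]
    have hmem : (1 : R) * g l ∈ Ideal.span (g '' {l}ᶜ) := by
      rw [← Finset.add_sum_erase _ _ (Finset.mem_univ l)] at hsum
      have : (1 : R) * g l = algebraMap k R (-(v l)⁻¹) * ∑ i ∈ Finset.univ.erase l, v i • g i := by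
        rw [← Algebra.smul_def, eq_neg_of_add_eq_zero_right hsum, smul_neg, neg_smul, neg_neg,
          smul_smul, inv_mul_cancel₀ hl, one_smul, one_mul]
      rw [this]
      refine Ideal.mul_mem_left _ _ (sum_mem fun j hj => ?_)
      rw [Algebra.smul_def]
      exact Ideal.mul_mem_left _ _ (Ideal.subset_span ⟨j, by simpa using hj, rfl⟩)
    have h1 := hg _ l (by simp) _ hmem
    have : (1 : R) ∈ maximalIdeal R := by
      refine Ideal.span_le.2 ?_ h1
      rintro _ ⟨j, -, rfl⟩
      exact hgm j
    exact (Ideal.ne_top_iff_one _).1 (maximalIdeal.isMaximal R).ne_top this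
  have hunit : IsUnit C.det := by
    rw [hCdet]
    exact (IsUnit.mk0 _ hc).map _
  have hspan : Ideal.span (Set.range g) = Ideal.span (Set.range f) := by
    apply le_antisymm <;> rw [Ideal.span_le] <;> rintro _ ⟨i, rfl⟩
    · rw [← hC]
      exact mulVec_mem C f i
    · have := det_mul_mem (K := Ideal.span (Set.range g)) C f
        (fun i => by rw [hC]; exact Ideal.subset_span ⟨i, rfl⟩) i
      exact (Ideal.unit_mul_mem_iff_mem _ hunit).1 this
  have hCA : (C * A).mulVec x = g := by rw [← Matrix.mulVec_mulVec, hA, hC]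
  have h := Linked.of_trans hu hCA hD hB
  refine ⟨hA, fun y hy => ?_, fun y hy => ?_⟩
  · rw [← hspan] at hy ⊢
    obtain ⟨e, he⟩ := h.colon_le y hy
    refine ⟨e * C.det, ?_⟩
    rwa [mul_assoc, ← Matrix.det_mul]
  · apply h.colon_det_le
    rw [hspan, Matrix.det_mul, mul_left_comm]
    exact Ideal.mul_mem_left _ _ hy

end Local

/-! ### From the local ring at the origin back to polynomials. -/

section Polynomial

theorem StronglyRegular.localization {R ι : Type*} [CommRing R] (M : Submonoid R) (L : Type*)
    [CommRing L] [Algebra R L] [IsLocalization M L] {u : ι → R} (hu : StronglyRegular u) :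
    StronglyRegular fun i => algebraMap R L (u i) := by
  intro s i hi y hy
  have himg : (fun i => algebraMap R L (u i)) '' s = algebraMap R L '' (u '' s) :=
    (Set.image_image _ _ _).symm
  rw [himg, ← Ideal.map_span] at hy ⊢
  obtain ⟨a, t, rfl⟩ := IsLocalization.exists_mk'_eq M y
  rw [mul_comm, IsLocalization.mul_mk'_eq_mk'_of_mul,
    IsLocalization.mk'_mem_map_algebraMap_iff] at hy
  rw [IsLocalization.mk'_mem_map_algebraMap_iff]
  obtain ⟨z, hz, hza⟩ := hy
  refine ⟨z, hz, hu s i hi _ ?_⟩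
  rwa [mul_assoc, mul_comm a]

variable {σ K : Type*} [Field K]

theorem stronglyRegular_X : StronglyRegular (X : σ → MvPolynomial σ K) := by
  classical
  intro s i hi y hy
  rw [mem_ideal_span_X_image] at hy ⊢
  intro m hm
  have : m + Finsupp.single i 1 ∈ (y * X i).support := by
    rw [mem_support_iff, coeff_mul_X]
    exact mem_support_iff.1 hm
  obtain ⟨j, hj, hmj⟩ := hy _ this
  refine ⟨j, hj, fun h0 => hmj ?_⟩
  have : i ≠ j := fun e => hi (e ▸ hj)
  simp [h0, this]

theorem mem_span_range_X_iff (y : MvPolynomial σ K) :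
    y ∈ Ideal.span (Set.range (X : σ → MvPolynomial σ K)) ↔ constantCoeff y = 0 := by
  rw [← Set.image_univ, mem_ideal_span_X_image]
  constructor
  · intro h
    rw [constantCoeff_eq]
    by_contra h0
    obtain ⟨i, -, hi⟩ := h 0 (mem_support_iff.2 h0)
    exact hi rfl
  · intro h m hm
    by_contra! hcon
    have : m = 0 := Finsupp.ext fun i => hcon i (Set.mem_univ i)
    subst this
    exact mem_support_iff.1 hm h

/-- Modulo `I`, `s` is a nonzero constant plus a nilpotent, hence a unit. -/
theorem exists_mul_sub_one_mem {I : Ideal (MvPolynomial σ K)} (hI : ∀ i, X i ∈ I.radical)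
    {s : MvPolynomial σ K} (hs : constantCoeff s ≠ 0) : ∃ w, w * s - 1 ∈ I := by
  have hmem : s - C (constantCoeff s) ∈ I.radical := by
    have : s - C (constantCoeff s) ∈ Ideal.span (Set.range (X : σ → MvPolynomial σ K)) := by
      rw [mem_span_range_X_iff]
      simp
    exact Ideal.span_le.2 (by rintro _ ⟨i, rfl⟩; exact hI i) this
  have hnil : IsNilpotent (Ideal.Quotient.mk I (s - C (constantCoeff s))) := by
    obtain ⟨N, hN⟩ := hmem
    exact ⟨N, by rw [← map_pow, Ideal.Quotient.eq_zero_iff_mem]; exact hN⟩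
  have hunit : IsUnit (Ideal.Quotient.mk I s) := by
    have h1 : IsUnit (Ideal.Quotient.mk I (C (constantCoeff s))) :=
      ((IsUnit.mk0 _ hs).map C).map _
    have := hnil.isUnit_add_left_of_commute h1 (Commute.all _ _)
    rwa [← map_add, add_sub_cancel] at this
  obtain ⟨w, hw⟩ := hunit.exists_left_inv
  obtain ⟨w, rfl⟩ := Ideal.Quotient.mk_surjective w
  refine ⟨w, ?_⟩
  rw [← Ideal.Quotient.eq_zero_iff_mem, map_sub, map_mul, hw, map_one, sub_self]

theorem linked_X_of_X_mem_radical [Infinite K] [Fintype σ] [DecidableEq σ]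
    {f : σ → MvPolynomial σ K} {A : Matrix σ σ (MvPolynomial σ K)} (hA : A.mulVec X = f)
    (hf : ∀ i, X i ∈ (Ideal.span (Set.range f)).radical) : Linked X f A := by
  let m : Ideal (MvPolynomial σ K) := RingHom.ker (constantCoeff : MvPolynomial σ K →+* K)
  have hm : m = Ideal.span (Set.range X) := Ideal.ext fun y => (mem_span_range_X_iff y).symm
  have : m.IsPrime := RingHom.ker_isPrime _
  let L := Localization.AtPrime m
  let φ : MvPolynomial σ K →+* L := algebraMap _ L
  have : IsNoetherianRing L := IsLocalization.isNoetherianRing m.primeCompl L inferInstance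
  have hrange : ∀ g : σ → MvPolynomial σ K, Ideal.span (Set.range fun i => φ (g i)) =
      (Ideal.span (Set.range g)).map φ := fun g => by
    rw [Ideal.map_span, ← Set.range_comp]
    rfl
  have hmax : Ideal.span (Set.range fun i => φ (X i)) = IsLocalRing.maximalIdeal L := by
    rw [hrange, ← hm]
    exact Localization.AtPrime.map_eq_maximalIdeal
  have hAL : (φ.mapMatrix A).mulVec (fun i => φ (X i)) = fun i => φ (f i) := by
    ext i
    rw [← hA]
    exact (RingHom.map_mulVec φ A X i).symm
  have hrad : IsLocalRing.maximalIdeal L ≤ (Ideal.span (Set.range fun i => φ (f i))).radical := by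
    rw [← hmax, Ideal.span_le]
    rintro _ ⟨i, rfl⟩
    obtain ⟨N, hN⟩ := hf i
    refine ⟨N, ?_⟩
    rw [← map_pow, hrange]
    exact Ideal.mem_map_of_mem φ hN
  have H := linked_of_maximalIdeal_le_radical K hAL
    (stronglyRegular_X.localization m.primeCompl L) hmax hrad
  have hdet : (φ.mapMatrix A).det = φ A.det := (RingHom.map_det φ A).symm
  refine ⟨hA, fun y hy => ?_, fun y hy => ?_⟩
  · obtain ⟨c, hc⟩ := H.colon_le (φ y) fun i => by
      rw [← map_mul, hrange]
      exact Ideal.mem_map_of_mem φ (hy i)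
    obtain ⟨a, t, rfl⟩ := IsLocalization.exists_mk'_eq m.primeCompl c
    have hc' : φ (t * y - a * A.det) ∈ (Ideal.span (Set.range f)).map φ := by
      rw [← hrange]
      have : φ (t * y - a * A.det) =
          φ t * (φ y - IsLocalization.mk' L a t * (φ.mapMatrix A).det) := by
        rw [hdet, mul_sub, ← mul_assoc, IsLocalization.mk'_spec', map_sub, map_mul, map_mul]
      rw [this]
      exact Ideal.mul_mem_left _ _ hc
    rw [IsLocalization.algebraMap_mem_map_algebraMap_iff m.primeCompl] at hc'
    obtain ⟨s, hs, hsy⟩ := hc'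
    have hst : constantCoeff (s * (t : MvPolynomial σ K)) ≠ 0 := (m.primeCompl.mul_mem hs t.2)
    obtain ⟨w, hw⟩ := exists_mul_sub_one_mem hf hst
    -- Since `w` inverts `s * t` modulo `(f)`, `y ≡ w * s * t * y ≡ w * s * a * det A`.
    refine ⟨w * s * a, ?_⟩
    have : y - w * s * a * A.det =
        w * (s * (t * y - a * A.det)) - y * (w * (s * (t : MvPolynomial σ K)) - 1) := by
      ring
    rw [this]
    exact sub_mem (Ideal.mul_mem_left _ _ hsy) (Ideal.mul_mem_left _ _ hw)
  · have := H.colon_det_le (φ y) (by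
      rw [hdet, ← map_mul, hrange]
      exact Ideal.mem_map_of_mem φ hy)
    rw [hmax] at this
    rw [← hm]
    exact (IsLocalization.AtPrime.to_map_mem_maximal_iff L m y).1 this

end Polynomial

/-! ### Graded algebras with socle spanned by one form. -/

section Socle

variable {σ K : Type*} [Field K]

/-- `I` is a homogeneous ideal, primary to the ideal of the origin, and `J` is a form of degree `N`
whose class is a basis of the socle of the quotient by `I`. -/
structure IsSocleGenerator (I : Ideal (MvPolynomial σ K)) (J : MvPolynomial σ K) (N : ℕ) :
    Prop where
  homogeneousComponent_mem : ∀ h ∈ I, ∀ k, homogeneousComponent k h ∈ I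
  X_mem_radical : ∀ i, X i ∈ I.radical
  isHomogeneous : J.IsHomogeneous N
  mul_X_mem : ∀ i, J * X i ∈ I
  notMem : J ∉ I
  exists_sub_mem : ∀ y, (∀ i, y * X i ∈ I) → ∃ c : K, y - C c * J ∈ I

namespace IsSocleGenerator

variable {I : Ideal (MvPolynomial σ K)} {J : MvPolynomial σ K} {N : ℕ}

theorem mem_of_sub_mem (H : IsSocleGenerator I J N) {k : ℕ} (hk : k ≠ N) {y : MvPolynomial σ K}
    (hy : y.IsHomogeneous k) {c : K} (hc : y - C c * J ∈ I) : y ∈ I := by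
  have := H.homogeneousComponent_mem _ hc k
  rwa [map_sub, homogeneousComponent_C_mul, homogeneousComponent_of_mem H.isHomogeneous,
    if_neg hk, mul_zero, sub_zero, homogeneousComponent_eq_self hy] at this

theorem ne_top (H : IsSocleGenerator I J N) : I ≠ ⊤ := fun h => H.notMem (h ▸ Submodule.mem_top)

theorem constantCoeff_eq_zero (H : IsSocleGenerator I J N) {h : MvPolynomial σ K} (hh : h ∈ I) :
    constantCoeff h = 0 := by
  by_contra h0
  obtain ⟨w, hw⟩ := exists_mul_sub_one_mem H.X_mem_radical h0
  apply H.ne_top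
  rw [Ideal.eq_top_iff_one]
  have : (1 : MvPolynomial σ K) = w * h - (w * h - 1) := by ring
  rw [this]
  exact sub_mem (Ideal.mul_mem_left _ _ hh) hw

theorem isUnit_mk_iff (H : IsSocleGenerator I J N) (s : MvPolynomial σ K) :
    IsUnit (Ideal.Quotient.mk I s) ↔ constantCoeff s ≠ 0 := by
  constructor
  · intro hs h0
    obtain ⟨w, hw⟩ := hs.exists_left_inv
    obtain ⟨w, rfl⟩ := Ideal.Quotient.mk_surjective w
    rw [← map_mul, ← map_one (Ideal.Quotient.mk I), Ideal.Quotient.eq] at hw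
    simpa [h0] using H.constantCoeff_eq_zero hw
  · intro h0
    obtain ⟨w, hw⟩ := exists_mul_sub_one_mem H.X_mem_radical h0
    rw [← Ideal.Quotient.eq, map_mul, map_one] at hw
    exact IsUnit.of_mul_eq_one_right _ hw

theorem isLocalRing (H : IsSocleGenerator I J N) : IsLocalRing (MvPolynomial σ K ⧸ I) := by
  have : Nontrivial (MvPolynomial σ K ⧸ I) := Ideal.Quotient.nontrivial_iff.2 H.ne_top
  refine IsLocalRing.of_nonunits_add fun a b ha hb => ?_
  obtain ⟨a, rfl⟩ := Ideal.Quotient.mk_surjective a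
  obtain ⟨b, rfl⟩ := Ideal.Quotient.mk_surjective b
  rw [mem_nonunits_iff, H.isUnit_mk_iff, not_not] at ha hb
  rw [mem_nonunits_iff, ← map_add, H.isUnit_mk_iff, not_not, map_add, ha, hb, add_zero]

theorem maximalIdeal_eq (H : IsSocleGenerator I J N) [IsLocalRing (MvPolynomial σ K ⧸ I)] :
    IsLocalRing.maximalIdeal (MvPolynomial σ K ⧸ I) =
      (Ideal.span (Set.range X)).map (Ideal.Quotient.mk I) := by
  ext a
  obtain ⟨a, rfl⟩ := Ideal.Quotient.mk_surjective a
  rw [IsLocalRing.mem_maximalIdeal, mem_nonunits_iff, H.isUnit_mk_iff, not_not,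
    ← mem_span_range_X_iff, Ideal.mem_map_iff_of_surjective _ Ideal.Quotient.mk_surjective]
  constructor
  · exact fun h => ⟨a, h, rfl⟩
  · rintro ⟨b, hb, hba⟩
    rw [mem_span_range_X_iff] at hb ⊢
    have := H.constantCoeff_eq_zero (Ideal.Quotient.eq.1 hba)
    rw [map_sub, hb, zero_sub, neg_eq_zero] at this
    exact this

theorem mk_mem_socle_iff (H : IsSocleGenerator I J N) [IsLocalRing (MvPolynomial σ K ⧸ I)]
    (y : MvPolynomial σ K) :
    Ideal.Quotient.mk I y ∈ socle (MvPolynomial σ K ⧸ I) ↔ ∃ c : K, y - C c * J ∈ I := by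
  have h1 : Ideal.Quotient.mk I y ∈ socle (MvPolynomial σ K ⧸ I) ↔ ∀ i, y * X i ∈ I := by
    rw [socle, H.maximalIdeal_eq, Ideal.map_span, Submodule.mem_annihilator_span, Subtype.forall]
    simp only [← Set.range_comp, Set.forall_mem_range, Function.comp_apply, smul_eq_mul,
      ← map_mul, Ideal.Quotient.eq_zero_iff_mem]
  rw [h1]
  refine ⟨H.exists_sub_mem y, ?_⟩
  rintro ⟨c, hc⟩ i
  have : y * X i = (y - C c * J) * X i + C c * (J * X i) := by ring
  rw [this]
  exact add_mem (Ideal.mul_mem_right _ _ hc) (Ideal.mul_mem_left _ _ (H.mul_X_mem i))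

variable [Finite σ]

theorem exists_pow_le (H : IsSocleGenerator I J N) :
    ∃ M, (Ideal.span (Set.range (X : σ → MvPolynomial σ K))) ^ M ≤ I := by
  refine Ideal.exists_pow_le_of_le_radical_of_fg ?_ ?_
  · rw [Ideal.span_le]
    rintro _ ⟨i, rfl⟩
    exact H.X_mem_radical i
  · exact Submodule.fg_span (Set.finite_range _)

/-- Descending induction from a degree where everything lies in `I`: a form whose products with the
variables lie in `I` is a socle element, and outside degree `N` it must vanish modulo `I`. -/
theorem mem_of_lt_degree (H : IsSocleGenerator I J N) {k : ℕ} (hk : N < k)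
    {y : MvPolynomial σ K} (hy : y.IsHomogeneous k) : y ∈ I := by
  obtain ⟨M, hM⟩ := H.exists_pow_le
  suffices ∀ j k, M ≤ k + j → N < k → ∀ y : MvPolynomial σ K, y.IsHomogeneous k → y ∈ I from
    this M k (by omega) hk y hy
  intro j
  induction j with
  | zero =>
    intro k hk _ y hy
    apply hM
    change y ∈ idealOfVars σ K ^ M
    rw [mem_pow_idealOfVars_iff]
    intro m hm
    by_contra hlt
    exact mem_support_iff.1 hm (hy.coeff_eq_zero (by omega))
  | succ j ih =>
    intro k hk hNk y hy
    obtain ⟨c, hc⟩ := H.exists_sub_mem y fun i =>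
      ih (k + 1) (by omega) (by omega) _ (hy.mul (isHomogeneous_X _ i))
    exact H.mem_of_sub_mem hNk.ne' hy hc

theorem exists_sub_mem_of_isHomogeneous (H : IsSocleGenerator I J N) {y : MvPolynomial σ K}
    (hy : y.IsHomogeneous N) : ∃ c : K, y - C c * J ∈ I :=
  H.exists_sub_mem y fun i => H.mem_of_lt_degree (Nat.lt_succ_self N)
    (hy.mul (isHomogeneous_X _ i))

/-- Nondegeneracy of multiplication into degree `N`: the hypothesis passes to each `h * X i`, so by
descending induction `h` is a socle element, and there are none outside degree `N`. -/
theorem mem_of_monomial_mul_mem (H : IsSocleGenerator I J N) {k : ℕ} {h : MvPolynomial σ K}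
    (hh : h.IsHomogeneous k) (hm : ∀ α : σ →₀ ℕ, α.degree + k = N → monomial α 1 * h ∈ I) :
    h ∈ I := by
  suffices ∀ j k, N < k + j → ∀ h : MvPolynomial σ K, h.IsHomogeneous k →
      (∀ α : σ →₀ ℕ, α.degree + k = N → monomial α 1 * h ∈ I) → h ∈ I from
    this (N + 1) k (by omega) h hh hm
  intro j
  induction j with
  | zero => exact fun k hk h hh _ => H.mem_of_lt_degree hk hh
  | succ j ih =>
    intro k hk h hh hm
    by_cases hkN : k = N
    · simpa using hm 0 (by simpa using hkN)
    · obtain ⟨c, hc⟩ := H.exists_sub_mem h fun i => by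
        refine ih (k + 1) (by omega) _ (hh.mul (isHomogeneous_X _ i)) fun α hα => ?_
        have := hm (α + Finsupp.single i 1) (by rw [map_add, Finsupp.degree_single]; omega)
        rwa [← one_mul (1 : K), ← monomial_mul, mul_assoc, mul_comm _ h] at this
      exact H.mem_of_sub_mem hkN hh hc

theorem isArtinianRing (H : IsSocleGenerator I J N) : IsArtinianRing (MvPolynomial σ K ⧸ I) := by
  have := H.isLocalRing
  rw [isArtinianRing_iff_isNilpotent_maximalIdeal, H.maximalIdeal_eq]
  obtain ⟨M, hM⟩ := H.exists_pow_le
  refine ⟨M, ?_⟩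
  rw [← Ideal.map_pow, Ideal.zero_eq_bot, Ideal.map_eq_bot_iff_le_ker, Ideal.mk_ker]
  exact hM

end IsSocleGenerator

theorem IsSocleGenerator.isGorensteinOfSocleDegree {n : ℕ} {I : Ideal (MvPolynomial (Fin n) ℂ)}
    {J : MvPolynomial (Fin n) ℂ} {N : ℕ} (H : IsSocleGenerator I J N) :
    IsGorensteinOfSocleDegree I N := by
  refine ⟨H.isArtinianRing, H.isLocalRing, ?_, ?_⟩
  · have := H.isLocalRing
    have hJ := (H.mk_mem_socle_iff J).2 ⟨1, by simp⟩
    refine finrank_eq_one_iff'.2 ⟨⟨Ideal.Quotient.mk I J, hJ⟩, ?_, ?_⟩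
    · intro h
      exact H.notMem (Ideal.Quotient.eq_zero_iff_mem.1 (congrArg Subtype.val h))
    · rintro ⟨w, hw⟩
      obtain ⟨y, rfl⟩ := Ideal.Quotient.mk_surjective w
      obtain ⟨c, hc⟩ := (H.mk_mem_socle_iff y).1 hw
      refine ⟨c, Subtype.ext ?_⟩
      rw [← Ideal.Quotient.eq] at hc
      change c • Ideal.Quotient.mk I J = Ideal.Quotient.mk I y
      rw [hc, ← smul_eq_C_mul]
      rfl
  · have := H.isLocalRing
    ext w
    obtain ⟨y, rfl⟩ := Ideal.Quotient.mk_surjective w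
    rw [SetLike.mem_coe, H.mk_mem_socle_iff]
    constructor
    · rintro ⟨c, hc⟩
      exact ⟨C c * J, H.isHomogeneous.C_mul c, (Ideal.Quotient.eq.2 hc).symm⟩
    · rintro ⟨h, hh, hhy⟩
      obtain ⟨c, hc⟩ := H.exists_sub_mem_of_isHomogeneous hh
      refine ⟨c, ?_⟩
      rw [Ideal.Quotient.eq] at hhy
      have : y - C c * J = (h - C c * J) - (h - y) := by ring
      rw [this]
      exact sub_mem hc hhy

end Socle

/-! ### The polar pairing and the associated form. -/

section Polar

variable {n : ℕ}

theorem iterPDeriv_zero : iterPDeriv (0 : Fin n →₀ ℕ) = 1 :=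
  (Finset.noncommProd_eq_pow_card _ _ _ 1 fun i _ => pow_zero (pd i)).trans (one_pow _)

theorem iterPDeriv_single (i : Fin n) (k : ℕ) :
    iterPDeriv (Finsupp.single i k) = pd i ^ k := by
  refine (Finset.mul_noncommProd_erase _ (Finset.mem_univ i) _ _).symm.trans ?_
  refine (congrArg _ ((Finset.noncommProd_eq_pow_card _ _ _ 1 fun j hj => ?_).trans
    (one_pow _))).trans ?_
  · rw [Finsupp.single_eq_of_ne (Finset.ne_of_mem_erase hj), pow_zero]
  · rw [mul_one, Finsupp.single_eq_same]

/-- The multi-index factorial `α₁! ⋯ αₙ!`. -/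
def multiFactorial (α : Fin n →₀ ℕ) : ℕ := ∏ i, (α i).factorial

theorem multiFactorial_ne_zero (α : Fin n →₀ ℕ) : (multiFactorial α : ℂ) ≠ 0 :=
  Nat.cast_ne_zero.2 (Finset.prod_ne_zero_iff.2 fun _ _ => Nat.factorial_ne_zero _)

theorem multiFactorial_zero : multiFactorial (0 : Fin n →₀ ℕ) = 1 := by
  simp [multiFactorial]

theorem multiFactorial_add_single (α : Fin n →₀ ℕ) (i : Fin n) :
    multiFactorial (α + Finsupp.single i 1) = multiFactorial α * (α i + 1) := by
  rw [multiFactorial, multiFactorial, ← Finset.mul_prod_erase _ _ (Finset.mem_univ i),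
    ← Finset.mul_prod_erase _ (fun j => (α j).factorial) (Finset.mem_univ i)]
  have : ∏ j ∈ Finset.univ.erase i, ((α + Finsupp.single i 1 : Fin n →₀ ℕ) j).factorial =
      ∏ j ∈ Finset.univ.erase i, (α j).factorial :=
    Finset.prod_congr rfl fun j hj => by
      rw [Finsupp.add_apply, Finsupp.single_eq_of_ne (Finset.ne_of_mem_erase hj), add_zero]
  rw [this, Finsupp.add_apply, Finsupp.single_eq_same, Nat.factorial_succ]
  ring

/-- The coefficient of `∂^α` on a monomial is `(β + α)! / β!`; factorials on both sides avoid the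
division. -/
theorem coeff_iterPDeriv (α : Fin n →₀ ℕ) : ∀ (β : Fin n →₀ ℕ) (p : MvPolynomial (Fin n) ℂ),
    coeff β (iterPDeriv α p) * multiFactorial β = coeff (β + α) p * multiFactorial (β + α) := by
  induction α using Finsupp.induction_linear with
  | zero => simp [iterPDeriv_zero]
  | add α α' h h' =>
    intro β p
    rw [iterPDeriv_add, Module.End.mul_apply, h, h', add_assoc]
  | single i k =>
    induction k with
    | zero => simp [iterPDeriv_zero]
    | succ k ih =>
      intro β p
      rw [iterPDeriv_single] at ih ⊢
      rw [pow_succ, Module.End.mul_apply, ih, Finsupp.single_add, ← add_assoc,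
        multiFactorial_add_single]
      have : coeff (β + Finsupp.single i k) (pd i p) =
          coeff (β + Finsupp.single i k + Finsupp.single i 1) p *
            ((β + Finsupp.single i k) i + 1 : ℕ) := by
        push_cast
        exact coeff_pderiv p _
      rw [this]
      push_cast
      ring

theorem coeff_zero_iterPDeriv (α : Fin n →₀ ℕ) (p : MvPolynomial (Fin n) ℂ) :
    coeff 0 (iterPDeriv α p) = coeff α p * multiFactorial α := by
  simpa [multiFactorial_zero] using coeff_iterPDeriv α 0 p

theorem coeff_zero_polar (h F : MvPolynomial (Fin n) ℂ) :
    coeff 0 (polar h F) = ∑ α ∈ h.support, coeff α h * (coeff α F * multiFactorial α) := by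
  simp [polar, coeff_sum, coeff_zero_iterPDeriv]

/-- The constant term of `(x^α h) ∘ F` is `α!` times the coefficient of `y^α` in `h ∘ F`. -/
theorem mem_perp_iff (h F : MvPolynomial (Fin n) ℂ) :
    h ∈ perp F ↔ ∀ α, coeff 0 (polar (monomial α 1 * h) F) = 0 := by
  change polar h F = 0 ↔ _
  simp only [polar_monomial_mul, one_smul, coeff_zero_iterPDeriv, mul_eq_zero,
    multiFactorial_ne_zero, or_false]
  exact MvPolynomial.ext_iff

theorem multiFactorial_mul_multinomial (α : Fin n →₀ ℕ) :
    multiFactorial α * α.multinomial = α.degree.factorial := by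
  rw [Finsupp.multinomial_eq_of_support_subset (Finset.subset_univ _), multiFactorial,
    Nat.multinomial_spec, Finsupp.degree_eq_sum]

theorem coeff_sum_X_mul_C_pow {A : Type*} [CommRing A] (a : Fin n → A) (N : ℕ)
    (α : Fin n →₀ ℕ) : coeff α ((∑ i, (X i : MvPolynomial (Fin n) A) * C (a i)) ^ N) =
      if α.degree = N then (α.multinomial : A) * ∏ i, a i ^ α i else 0 := by
  have := coeff_linearCombination_X_pow_of_fintype a α N
  simp only [smul_eq_C_mul, mul_comm (C _)] at this
  rw [this, Finsupp.prod_fintype _ _ fun _ => pow_zero _, Finsupp.degree_apply]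
  rfl

theorem isAssociatedForm_iff (I : Ideal (MvPolynomial (Fin n) ℂ)) (s : MvPolynomial (Fin n) ℂ)
    (N : ℕ) (F : MvPolynomial (Fin n) ℂ) : IsAssociatedForm I s N F ↔ F.IsHomogeneous N ∧
      ∀ α : Fin n →₀ ℕ, α.degree = N →
        C (α.multinomial : ℂ) * monomial α 1 - C (coeff α F) * s ∈ I := by
  refine and_congr_right fun hF => ?_
  rw [MvPolynomial.ext_iff]
  refine forall_congr' fun α => ?_
  rw [coeff_sum_X_mul_C_pow, mul_comm (MvPolynomial.map _ F), coeff_C_mul, coeff_map,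
    mul_comm (Ideal.Quotient.mk I s)]
  by_cases hα : α.degree = N
  · rw [if_pos hα, ← Ideal.Quotient.eq, monomial_eq, C_1, one_mul,
      Finsupp.prod_fintype _ _ fun _ => pow_zero _]
    simp only [map_mul, map_prod, map_pow, map_natCast, hα, true_imp_iff]
    rfl
  · simp [hα, hF.coeff_eq_zero hα]

namespace IsSocleGenerator

variable {I : Ideal (MvPolynomial (Fin n) ℂ)} {J F : MvPolynomial (Fin n) ℂ} {N : ℕ}

theorem C_mul_mem_iff (H : IsSocleGenerator I J N) (c : ℂ) : C c * J ∈ I ↔ c = 0 := by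
  refine ⟨fun h => ?_, fun h => by simp [h]⟩
  by_contra hc
  apply H.notMem
  have := I.mul_mem_left (C c⁻¹) h
  rwa [← mul_assoc, ← C_mul, inv_mul_cancel₀ hc, C_1, one_mul] at this

theorem existsUnique_isAssociatedForm (H : IsSocleGenerator I J N) :
    ∃! F, IsAssociatedForm I J N F := by
  have hc : ∀ α : Fin n →₀ ℕ, ∃ c : ℂ, α.degree = N → monomial α 1 - C c * J ∈ I := fun α => by
    by_cases hα : α.degree = N
    · obtain ⟨c, hc⟩ := H.exists_sub_mem_of_isHomogeneous (isHomogeneous_monomial (1 : ℂ) hα)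
      exact ⟨c, fun _ => hc⟩
    · exact ⟨0, fun h => absurd h hα⟩
  choose c hc using hc
  -- `G` supplies the multinomial coefficients, and its support is the finite set of exponents over
  -- which `F` is summed.
  set G : MvPolynomial (Fin n) ℂ := (∑ i, X i) ^ N with hG
  have hGc : ∀ α : Fin n →₀ ℕ, coeff α G = if α.degree = N then (α.multinomial : ℂ) else 0 :=
    fun α => by
      rw [hG, coeff_sum_X_pow_of_fintype, Nat.cast_ite, Nat.cast_zero, Finsupp.degree_apply]
      rfl
  let F : MvPolynomial (Fin n) ℂ := ∑ α ∈ G.support, monomial α (coeff α G * c α)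
  have hF : ∀ α, coeff α F = coeff α G * c α := fun α => by
    simp only [F, coeff_sum, coeff_monomial, Finset.sum_ite_eq', mem_support_iff]
    by_cases h : coeff α G = 0 <;> simp [h]
  refine ⟨F, (isAssociatedForm_iff _ _ _ _).2 ⟨?_, fun α hα => ?_⟩, fun F' hF' => ?_⟩
  · refine IsHomogeneous.sum _ _ _ fun α hα => isHomogeneous_monomial _ ?_
    by_contra h
    rw [mem_support_iff, hGc, if_neg h] at hα
    exact hα rfl
  · rw [hF, hGc, if_pos hα, C_mul, mul_assoc, ← mul_sub]
    exact I.mul_mem_left _ (hc α hα)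
  · replace hF' := (isAssociatedForm_iff _ _ _ _).1 hF'
    ext α
    by_cases hα : α.degree = N
    · rw [← sub_eq_zero, ← H.C_mul_mem_iff]
      have h1 := hF'.2 α hα
      have h2 := I.mul_mem_left (C (α.multinomial : ℂ)) (hc α hα)
      have : C (coeff α F' - coeff α F) * J =
          C (α.multinomial : ℂ) * (monomial α 1 - C (c α) * J) -
            (C (α.multinomial : ℂ) * monomial α 1 - C (coeff α F') * J) := by
        rw [hF, hGc, if_pos hα, C_sub, C_mul]
        ring
      rw [this]
      exact sub_mem h2 h1
    · rw [hF'.1.coeff_eq_zero hα, hF, hGc, if_neg hα, zero_mul]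

/-- Weight the defining relation for each `α` by `α!` times the coefficient of `g`, and use that
`α!` times the multinomial coefficient is `N!`. -/
theorem sub_coeff_zero_polar_mem (hF : IsAssociatedForm I J N F)
    {g : MvPolynomial (Fin n) ℂ} (hg : g.IsHomogeneous N) :
    C (N.factorial : ℂ) * g - C (coeff 0 (polar g F)) * J ∈ I := by
  rw [isAssociatedForm_iff] at hF
  have : C (N.factorial : ℂ) * g - C (coeff 0 (polar g F)) * J =
      ∑ α ∈ g.support, C (coeff α g * multiFactorial α) *
        (C (α.multinomial : ℂ) * monomial α 1 - C (coeff α F) * J) := by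
    have hg' : C (N.factorial : ℂ) * g =
        ∑ α ∈ g.support, C (N.factorial : ℂ) * (C (coeff α g) * monomial α 1) := by
      rw [← Finset.mul_sum]
      conv_lhs => rw [g.as_sum]
      simp only [C_mul_monomial, mul_one]
    rw [hg', coeff_zero_polar, map_sum, Finset.sum_mul, ← Finset.sum_sub_distrib]
    refine Finset.sum_congr rfl fun α hα => ?_
    have hdeg : α.degree = N := by
      by_contra h
      exact mem_support_iff.1 hα (hg.coeff_eq_zero h)
    rw [← hdeg, ← multiFactorial_mul_multinomial]
    push_cast
    simp only [C_mul]
    ring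
  rw [this]
  refine sum_mem fun α hα => I.mul_mem_left _ (hF.2 α ?_)
  by_contra h
  exact mem_support_iff.1 hα (hg.coeff_eq_zero h)

theorem coeff_zero_polar_eq_zero_iff (H : IsSocleGenerator I J N) (hF : IsAssociatedForm I J N F)
    {g : MvPolynomial (Fin n) ℂ} (hg : g.IsHomogeneous N) : coeff 0 (polar g F) = 0 ↔ g ∈ I := by
  have h := sub_coeff_zero_polar_mem hF hg
  have hN : (N.factorial : ℂ) ≠ 0 := Nat.cast_ne_zero.2 N.factorial_ne_zero
  rw [← H.C_mul_mem_iff]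
  constructor
  · intro h0
    have := I.mul_mem_left (C (N.factorial : ℂ)⁻¹) (add_mem h h0)
    rwa [sub_add_cancel, ← mul_assoc, ← C_mul, inv_mul_cancel₀ hN, C_1, one_mul] at this
  · intro hgI
    have := sub_mem (I.mul_mem_left (C (N.factorial : ℂ)) hgI) h
    rwa [sub_sub_cancel] at this

theorem coeff_zero_polar_homogeneousComponent (hF : F.IsHomogeneous N)
    (g : MvPolynomial (Fin n) ℂ) :
    coeff 0 (polar (homogeneousComponent N g) F) = coeff 0 (polar g F) := by
  rw [coeff_zero_polar, coeff_zero_polar, support_homogeneousComponent, Finset.sum_filter]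
  refine Finset.sum_congr rfl fun α _ => ?_
  rw [coeff_homogeneousComponent]
  split_ifs with h
  · rfl
  · rw [hF.coeff_eq_zero h, zero_mul, mul_zero]

theorem homogeneousComponent_monomial_mul (α : Fin n →₀ ℕ) (k : ℕ) (h : MvPolynomial (Fin n) ℂ) :
    homogeneousComponent (α.degree + k) (monomial α 1 * h) =
      monomial α 1 * homogeneousComponent k h := by
  ext β
  rw [coeff_homogeneousComponent, coeff_monomial_mul', coeff_monomial_mul',
    coeff_homogeneousComponent]
  by_cases hle : α ≤ β
  · obtain ⟨γ, rfl⟩ := exists_add_of_le hle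
    simp
  · simp [hle]

/-- Membership in `F^⊥` says that the degree `N` part of every monomial multiple of `h` lies in `I`;
nondegeneracy, applied to each homogeneous component, turns this into `h ∈ I`. -/
theorem eq_perp (H : IsSocleGenerator I J N) (hF : IsAssociatedForm I J N F) : I = perp F := by
  have key : ∀ g, coeff 0 (polar g F) = 0 ↔ homogeneousComponent N g ∈ I := fun g => by
    rw [← coeff_zero_polar_homogeneousComponent hF.1,
      H.coeff_zero_polar_eq_zero_iff hF (homogeneousComponent_isHomogeneous N g)]
  ext h
  simp only [mem_perp_iff, key]
  refine ⟨fun hh α => H.homogeneousComponent_mem _ (I.mul_mem_left _ hh) N, fun hh => ?_⟩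
  rw [← sum_homogeneousComponent h]
  refine sum_mem fun k _ => H.mem_of_monomial_mul_mem (homogeneousComponent_isHomogeneous k h) ?_
  rintro α rfl
  rw [← homogeneousComponent_monomial_mul]
  exact hh α

theorem isMacaulayInverseSystem (H : IsSocleGenerator I J N) (hF : IsAssociatedForm I J N F) :
    IsMacaulayInverseSystem I N F :=
  ⟨H.homogeneousComponent_mem, H.isGorensteinOfSocleDegree, hF.1, H.eq_perp hF⟩

end IsSocleGenerator

end Polar

/-! ### Jacobians, Hessians and isolated singularities. -/

section Forms

variable {n d : ℕ}

theorem X_mem_radical_tupleIdeal {f : Fin n → MvPolynomial (Fin n) ℂ} (hf : ResultantNeZero f)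
    (i : Fin n) : X i ∈ (tupleIdeal f).radical := by
  rw [← vanishingIdeal_zeroLocus_eq_radical (K := ℂ), mem_vanishingIdeal_iff]
  intro x hx
  have : x = 0 := hf x fun j => by
    have := mem_zeroLocus_iff.1 hx (f j) (Ideal.subset_span ⟨j, rfl⟩)
    rwa [aeval_eq_eval] at this
  simp [this]

theorem isSocleGenerator_jac (hd : 3 ≤ d) {f : Fin n → MvPolynomial (Fin n) ℂ}
    (hf : ∀ i, (f i).IsHomogeneous (d - 1)) (hres : ResultantNeZero f) :
    IsSocleGenerator (tupleIdeal f) (jac f) (n * (d - 2)) := by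
  have hd0 : ((d - 1 : ℕ) : ℂ) ≠ 0 := Nat.cast_ne_zero.2 (by omega)
  -- Euler's relation yields `(d - 1) • f i` instead of `f i`; the scalar is invertible.
  have hspan : Ideal.span (Set.range fun i => ((d - 1 : ℕ) : ℂ) • f i) = tupleIdeal f := by
    apply le_antisymm <;> refine Ideal.span_le.2 ?_ <;> rintro _ ⟨i, rfl⟩
    · exact Submodule.smul_of_tower_mem _ _ (Ideal.subset_span ⟨i, rfl⟩)
    · have : f i = ((d - 1 : ℕ) : ℂ)⁻¹ • ((d - 1 : ℕ) : ℂ) • f i := by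
        rw [smul_smul, inv_mul_cancel₀ hd0, one_smul]
      rw [SetLike.mem_coe, this]
      exact Submodule.smul_of_tower_mem _ _ (Ideal.subset_span ⟨i, rfl⟩)
  have hA : (Matrix.of fun i j => pderiv j (f i)).mulVec X =
      fun i => ((d - 1 : ℕ) : ℂ) • f i := by
    ext1 i
    rw [Nat.cast_smul_eq_nsmul, ← (hf i).sum_X_mul_pderiv]
    simp [Matrix.mulVec, dotProduct, mul_comm]
  have H := linked_X_of_X_mem_radical hA (by rw [hspan]; exact X_mem_radical_tupleIdeal hres)
  let _ : GradedAlgebra (homogeneousSubmodule (Fin n) ℂ) := gradedAlgebra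
  have hhom : (tupleIdeal f).IsHomogeneous (homogeneousSubmodule (Fin n) ℂ) := by
    apply Ideal.homogeneous_span
    rintro _ ⟨i, rfl⟩
    exact ⟨d - 1, hf i⟩
  have hmul : ∀ i, jac f * X i ∈ tupleIdeal f :=
    det_mul_mem _ X fun i => by
      rw [hA, ← hspan]
      exact Ideal.subset_span ⟨i, rfl⟩
  refine ⟨fun h hh k => homogeneousComponent_mem_of_mem hhom hh k, X_mem_radical_tupleIdeal hres,
    ?_, hmul, fun hJ => ?_, fun y hy => ?_⟩
  · rw [jac, Matrix.det_apply]
    refine IsHomogeneous.sum _ _ _ fun τ _ => ?_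
    have : (∏ i, Matrix.of (fun i j => pderiv j (f i)) (τ i) i).IsHomogeneous (n * (d - 2)) := by
      have := IsHomogeneous.prod Finset.univ
        (fun i => Matrix.of (fun i j => pderiv j (f i)) (τ i) i) (fun _ => d - 2) fun i _ => by
          have := (hf (τ i)).pderiv (i := i)
          rwa [Nat.sub_sub] at this
      simpa using this
    rw [Units.smul_def]
    exact (homogeneousSubmodule (Fin n) ℂ _).smul_of_tower_mem _ this
  · have := H.colon_det_le 1 (by rw [one_mul, hspan]; exact hJ)
    rw [mem_span_range_X_iff] at this
    simp at this
  · obtain ⟨c, hc⟩ := H.colon_le y (by rwa [hspan])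
    rw [hspan] at hc
    -- Only the constant term of `c` matters, as `jac f` multiplies the variables into the ideal.
    refine ⟨constantCoeff c, ?_⟩
    have h0 : jac f * (c - C (constantCoeff c)) ∈ tupleIdeal f := by
      have hmem : c - C (constantCoeff c) ∈ Ideal.span (Set.range X) := by
        rw [mem_span_range_X_iff]
        simp
      have hle : Ideal.span (Set.range X) ≤ (tupleIdeal f).colon {jac f} := by
        rw [Ideal.span_le]
        rintro _ ⟨i, rfl⟩
        simpa [Submodule.mem_colon_singleton, mul_comm] using hmul i
      simpa [Submodule.mem_colon_singleton, mul_comm] using hle hmem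
    have : y - C (constantCoeff c) * jac f =
        (y - c * jac f) + jac f * (c - C (constantCoeff c)) := by ring
    rw [this]
    exact add_mem hc h0

theorem associatedForm_tuple (hd : 3 ≤ d) {f : Fin n → MvPolynomial (Fin n) ℂ}
    (hf : ∀ i, (f i).IsHomogeneous (d - 1)) (hres : ResultantNeZero f) :
    (∃! F, IsAssociatedForm (tupleIdeal f) (jac f) (n * (d - 2)) F) ∧
      IsMacaulayInverseSystem (tupleIdeal f) (n * (d - 2)) (assocFormTuple d f) := by
  have H := isSocleGenerator_jac hd hf hres
  have hex := H.existsUnique_isAssociatedForm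
  exact ⟨hex, H.isMacaulayInverseSystem (Classical.epsilon_spec hex.exists)⟩

theorem jac_grad (f : MvPolynomial (Fin n) ℂ) : jac (grad f) = hess f := by
  rw [jac, ← Matrix.det_transpose]
  rfl

theorem eval_smul_of_isHomogeneous {p : MvPolynomial (Fin n) ℂ} {k : ℕ} (hp : p.IsHomogeneous k)
    (t : ℂ) (x : Fin n → ℂ) : eval (t • x) p = t ^ k * eval x p := by
  rw [eval_eq', eval_eq', Finset.mul_sum]
  refine Finset.sum_congr rfl fun α hα => ?_
  have hdeg : ∑ i, α i = k := by
    rw [← Finsupp.degree_eq_sum]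
    by_contra h
    exact mem_support_iff.1 hα (hp.coeff_eq_zero h)
  simp only [Pi.smul_apply, smul_eq_mul, mul_pow, Finset.prod_mul_distrib,
    Finset.prod_pow_eq_pow_sum, hdeg]
  ring

/-- By homogeneity a nonzero common zero of the partials spans a line of such zeros; `f` vanishes on
it by Euler's relation, so singular points accumulate at the origin. -/
theorem resultantNeZero_grad (hd : 3 ≤ d) {f : MvPolynomial (Fin n) ℂ} (hf : f.IsHomogeneous d)
    (hdisc : DiscriminantNeZero f) : ResultantNeZero (grad f) := by
  intro x hx
  by_contra hx0
  have hsing : ∀ t : ℂ, eval (t • x) f = 0 ∧ ∀ i, eval (t • x) (pderiv i f) = 0 := by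
    intro t
    have hgrad : ∀ i, eval (t • x) (pderiv i f) = 0 := fun i => by
      rw [eval_smul_of_isHomogeneous hf.pderiv]
      exact mul_eq_zero_of_right _ (hx i)
    refine ⟨?_, hgrad⟩
    have := congrArg (eval (t • x)) hf.sum_X_mul_pderiv
    simp only [map_sum, map_mul, hgrad, mul_zero, Finset.sum_const_zero, map_nsmul] at this
    exact (smul_eq_zero.1 this.symm).resolve_left (by omega)
  have htend : Tendsto (fun t : ℂ => t • x) (𝓝[≠] 0) (𝓝[≠] 0) := by
    refine tendsto_nhdsWithin_iff.2 ⟨?_, ?_⟩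
    · have : Tendsto (fun t : ℂ => t • x) (𝓝 0) (𝓝 ((0 : ℂ) • x)) :=
        (continuous_id.smul continuous_const).tendsto 0
      rw [zero_smul] at this
      exact this.mono_left nhdsWithin_le_nhds
    · filter_upwards [self_mem_nhdsWithin] with t ht
      exact smul_ne_zero ht hx0
  obtain ⟨t, ht⟩ := (htend.eventually hdisc).exists
  exact ht (hsing t)

end Forms

end AssocForm

theorem proposition2p7 (n d : ℕ) (hn : 2 ≤ n) (hd : 3 ≤ d) :
    (∀ f : Fin n → MvPolynomial (Fin n) ℂ, (∀ i, (f i).IsHomogeneous (d - 1)) →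
      AssocForm.ResultantNeZero f →
        (∃! F, AssocForm.IsAssociatedForm (AssocForm.tupleIdeal f) (AssocForm.jac f)
          (n * (d - 2)) F) ∧
        AssocForm.IsMacaulayInverseSystem (AssocForm.tupleIdeal f) (n * (d - 2))
          (AssocForm.assocFormTuple d f)) ∧
    (∀ f : MvPolynomial (Fin n) ℂ, f.IsHomogeneous d →
      AssocForm.DiscriminantNeZero f →
        (∃! F, AssocForm.IsAssociatedForm (AssocForm.tupleIdeal (AssocForm.grad f))
          (AssocForm.hess f) (n * (d - 2)) F) ∧
        AssocForm.IsMacaulayInverseSystem (AssocForm.tupleIdeal (AssocForm.grad f))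
          (n * (d - 2)) (AssocForm.assocForm d f)) := by
  refine ⟨fun f hf hres => AssocForm.associatedForm_tuple hd hf hres, fun f hf hdisc => ?_⟩
  have h := AssocForm.associatedForm_tuple (f := AssocForm.grad f) hd (fun i => hf.pderiv)
    (AssocForm.resultantNeZero_grad hd hf hdisc)
  rw [AssocForm.jac_grad] at h
  refine ⟨h.1, ?_⟩
  have hA : AssocForm.assocFormTuple d (AssocForm.grad f) = AssocForm.assocForm d f := by
    rw [AssocForm.assocFormTuple, AssocForm.jac_grad, AssocForm.assocForm]
  rw [← hA]
  exact h.2
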